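/- **Theorem 3 (Performance of the Anchored Thresholding Estimator).** For each stage $k\in\mathbb N$ let $n_c=n_c(k)$ and $n_o=n_o(k)$ be sample sizes with $n_c\wedge n_o\to\infty$ as $k\to\infty$. One observes records $(X_i,A_i,Y_i)$ (covariates, binary treatment, real outcome): $n_c$ records, $i\in\mathcal C$, that are i.i.d. from an RCT population, and, independently of them, $n_o$ records, $i\in\mathcal O$, that are i.i.d. from an observational population (the two laws may depend on $k$). Let $\beta^\star,\beta_o\in\mathbb R$ (possibly depending on $k$) be the target parameter and the centre of the observational estimator, $\Delta=\beta^\star-\beta_o$ the bias, and $\overline\Delta\ge 0$ (possibly depending on $k$) a number with $|\Delta|\le\overline\Delta$. Let $\hat\beta_c,\hat\beta_o,\hat\sigma_c,\hat\sigma_o$ be real random variables (estimators). *Asymptotic linearity.* There are influence functions $\psi_c,\psi_o$ of $(X,A,Y)$ such that $$\sqrt{n_c}(\hat\beta_c-\beta^\star)=\frac1{\sqrt{n_c}}\sum_{i\in\mathcal C}\psi_c(X_i,A_i,Y_i)+o_p(1),\qquad \sqrt{n_o}(\hat\beta_o-\beta_o)=\frac1{\sqrt{n_o}}\sum_{i\in\mathcal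 O}\psi_o(X_i,A_i,Y_i)+o_p(1),$$ where $\psi_c$ and $\psi_o$ have mean zero, second moments $\sigma_c^2$ and $\sigma_o^2$, and finite third absolute moments $\rho_c$ and $\rho_o$ under the respective populations; $\sigma_c,\sigma_o>0$, $\rho_c$ and $\rho_o$ do not depend on $k$. *Further assumptions.* $\hat\sigma_c\to\sigma_c$ and $\hat\sigma_o\to\sigma_o$ in probability; and there are constants $\kappa,\lambda_0>0$ such that $\sigma_c^2/n_c\ge\kappa\,\sigma_o^2/n_o$ and the tuning parameter $\lambda=\lambda(k)$ satisfies $\lambda\ge\lambda_0$ for all large $k$. *Estimator.* Put $\tilde\Delta=\hat\beta_c-\hat\beta_o$, $\hat s=\sqrt{\hat\sigma_c^2/n_c+\hat\sigma_o^2/n_o}$, let $\hat\Delta_\lambda$ be the soft-thresholding of $\tilde\Delta$ at level $\lambda\hat s$, i.e. $\hat\Delta_\lambda=\operatorname{sgn}(\tilde\Delta)(|\tilde\Delta|-\lambda\hat s)$ if $|\tilde\Delta|\ge\lambda\hat s$ and $\hat\Delta_\lambda=0$ otherwise (for $\lambda\ge 0$ the point $\delta$ of least absolute value with $|\delta-\tilde\Delta|\le\lambda\hat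 s$), and put $$\hat\omega=\frac{\hat\sigma_c^2/n_c}{\hat\sigma_c^2/n_c+\hat\sigma_o^2/n_o},\qquad \hat\beta_\lambda=(1-\hat\omega)\hat\beta_c+\hat\omega(\hat\beta_o+\hat\Delta_\lambda),\qquad R=\frac{\sigma_c^2\sigma_o^2}{n_c\sigma_o^2+n_o\sigma_c^2}+\min\Big(\frac{\sigma_c^2}{n_c},\overline\Delta^2\Big).$$ *Conclusion.* There is an absolute constant $c>0$ and a constant $C>0$ depending only on $\kappa$ and $\lambda_0$ such that, in every such setting, $$\mathbb P\Big(|\hat\beta_\lambda-\beta^\star|^2\le C\,\lambda^2R\Big)\ \ge\ 1-o(1)-e^{-c\lambda^2}\qquad(k\to\infty).$$ In particular, if $a\sqrt{\log(n_c\wedge n_o)}\le\lambda\le b\sqrt{\log(n_c\wedge n_o)}$ for all large $k$, with constants $a,b>0$, then $|\hat\beta_\lambda-\beta^\star|^2\le C\,b^2\log(n_c\wedge n_o)\,R$ with probability tending to one. -/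

import Mathlib

open MeasureTheory ProbabilityTheory Filter Topology

universe u v

namespace AnchoredThresholding

/-- What is observed on one unit: covariates `X`, treatment `A`, outcome `Y`. -/
abbrev Record (𝒳 : Type v) := 𝒳 × Bool × ℝ

/-- The sampling scheme. At stage `k` the RCT contributes `nc k` records with common law `Qc k`,
the observational study contributes `no k` records with common law `Qo k`, and all these
records are mutually independent. -/
structure IndependentSamples {Ω : Type u} {𝒳 : Type v} [MeasurableSpace Ω] [MeasurableSpace 𝒳]
    (P : Measure Ω) (nc no : ℕ → ℕ) (Qc Qo : ℕ → Measure (Record 𝒳))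
    (Zc : (k : ℕ) → Fin (nc k) → Ω → Record 𝒳)
    (Zo : (k : ℕ) → Fin (no k) → Ω → Record 𝒳) : Prop where
  measurable_rct : ∀ k i, Measurable (Zc k i)
  measurable_obs : ∀ k i, Measurable (Zo k i)
  law_rct : ∀ k i, P.map (Zc k i) = Qc k
  law_obs : ∀ k i, P.map (Zo k i) = Qo k
  indep : ∀ k, iIndepFun (Sum.elim (Zc k) (Zo k)) P

/-- The estimator `βhat` of `β`, computed at stage `k` from `n k` records `Z k i` of law `Q k`, has
an asymptotic linear expansion with influence function `ψ k`, which has mean zero, second moment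
`σ ^ 2` and finite third absolute moment `ρ`. -/
structure AsymptoticallyLinear {Ω : Type u} {𝒳 : Type v} [MeasurableSpace Ω] [MeasurableSpace 𝒳]
    (P : Measure Ω) (n : ℕ → ℕ) (Q : ℕ → Measure (Record 𝒳))
    (Z : (k : ℕ) → Fin (n k) → Ω → Record 𝒳)
    (βhat : ℕ → Ω → ℝ) (β : ℕ → ℝ) (ψ : ℕ → Record 𝒳 → ℝ) (σ ρ : ℝ) : Prop where
  measurable_influence : ∀ k, Measurable (ψ k)
  third_moment_finite : ∀ k, MemLp (ψ k) 3 (Q k)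
  mean_zero : ∀ k, ∫ z, ψ k z ∂(Q k) = 0
  second_moment : ∀ k, ∫ z, ψ k z ^ 2 ∂(Q k) = σ ^ 2
  third_moment : ∀ k, ∫ z, |ψ k z| ^ 3 ∂(Q k) = ρ
  expansion : TendstoInMeasure P
    (fun k w => √(n k : ℝ) * (βhat k w - β k) - (1 / √(n k : ℝ)) * ∑ i, ψ k (Z k i w))
    atTop (fun _ => 0)

/-- Soft-thresholding of `x` at level `r`. -/
noncomputable def softThreshold (r x : ℝ) : ℝ :=
  if r ≤ |x| then Real.sign x * (|x| - r) else 0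

/-- For a nonnegative level, `softThreshold r x` is the unique point of smallest absolute value
among all `δ` with `|δ - x| ≤ r`. -/
theorem softThreshold_eq_iff {r x : ℝ} (hr : 0 ≤ r) (d : ℝ) :
    d = softThreshold r x ↔ |d - x| ≤ r ∧ ∀ δ : ℝ, |δ - x| ≤ r → |d| ≤ |δ| := by
  have key : |softThreshold r x - x| ≤ r ∧ ∀ δ : ℝ, |δ - x| ≤ r →
      |softThreshold r x| ≤ |δ| ∧ (|δ| = |softThreshold r x| → δ = softThreshold r x) := by
    unfold softThreshold
    split_ifs with h
    · rcases lt_trichotomy x 0 with hx | hx | hx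
      · rw [Real.sign_of_neg hx, abs_of_neg hx] at *
        refine ⟨by rw [abs_le]; constructor <;> linarith, fun δ hδ => ?_⟩
        rw [abs_le] at hδ
        have h1 : -1 * (-x - r) ≤ 0 := by linarith
        rw [abs_of_nonpos h1, abs_of_nonpos (by linarith : δ ≤ 0)]
        exact ⟨by linarith, fun _ => by linarith⟩
      · subst hx
        have hr0 : r = 0 := by
          rw [abs_zero] at h
          linarith
        subst hr0
        simp
      · rw [Real.sign_of_pos hx, abs_of_pos hx] at *
        refine ⟨by rw [abs_le]; constructor <;> linarith, fun δ hδ => ?_⟩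
        rw [abs_le] at hδ
        have h1 : 0 ≤ 1 * (x - r) := by linarith
        rw [abs_of_nonneg h1, abs_of_nonneg (by linarith : 0 ≤ δ)]
        exact ⟨by linarith, fun _ => by linarith⟩
    · refine ⟨?_, fun δ _ => ?_⟩
      · rw [zero_sub, abs_neg]
        linarith
      · simp
  constructor
  · rintro rfl
    exact ⟨key.1, fun δ hδ => (key.2 δ hδ).1⟩
  · rintro ⟨h1, h2⟩
    exact (key.2 d h1).2 (le_antisymm (h2 _ key.1) (key.2 d h1).1)

/-- The estimated bias: the difference of the two estimators, soft-thresholded at `lam` times its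
estimated standard deviation. -/
noncomputable def biasEstimate (nc no : ℕ) (lam bc bo sc so : ℝ) : ℝ :=
  softThreshold (lam * √(sc ^ 2 / nc + so ^ 2 / no)) (bc - bo)

/-- The estimated inverse-variance weight of the observational estimator. -/
noncomputable def weightEstimate (nc no : ℕ) (sc so : ℝ) : ℝ :=
  (sc ^ 2 / nc) / (sc ^ 2 / nc + so ^ 2 / no)

/-- The anchored thresholding estimator, from the RCT estimate `bc`, the observational estimate
`bo` and the standard deviation estimates `sc`, `so`. -/
noncomputable def anchoredEstimate (nc no : ℕ) (lam bc bo sc so : ℝ) : ℝ :=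
  (1 - weightEstimate nc no sc so) * bc
    + weightEstimate nc no sc so * (bo + biasEstimate nc no lam bc bo sc so)

/-- The rate of the oracle estimator that knows the bound `Dbar` on the bias. -/
noncomputable def oracleRate (nc no : ℕ) (σc σo Dbar : ℝ) : ℝ :=
  σc ^ 2 * σo ^ 2 / (nc * σo ^ 2 + no * σc ^ 2) + min (σc ^ 2 / nc) (Dbar ^ 2)

end AnchoredThresholding

/-! Write `U`, `W` for the errors of the RCT and observational estimators, `D` for the bias, and
`vc`, `vo` for the variances `σc ^ 2 / nc`, `σo ^ 2 / no`. The total error is `(1 - ω) * U + ω * (W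
+ (Δ̂ - D))`, and the thresholded quantity is `D + U - W`.

Deterministic part (`sq_weighted_error_le`): suppose the estimated variances are correct up to a
factor 4, `U` and `W` are at most `B * lam` standard deviations, and `U - W` is at most `lam / 2` of
its own. Then `D` lies within the threshold of `D + U - W`. Soft-thresholding picks the admissible
point of least absolute value, so `|Δ̂ - D|` is at most twice the threshold and at most `2 * |D|`;
this yields the minimum in the oracle rate without knowledge of the bias bound. The weights reduce
the contribution of `U` to order `vc * vo / (vc + vo)`, and `κ * vo ≤ vc` does the same for `W`.

Probabilistic part: a Lyapunov central limit theorem, proved with characteristic functions because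
the laws vary with `k`, gives Gaussian tails for `U`, `W` and `U - W` at each fixed threshold. Since
`lam` moves with `k` and may diverge, the bounds must be uniform in the threshold; monotonicity of
tails and compactness provide this (`eventually_forall_ge_le_add`). To reach `exp (-c * lam ^ 2)`
without a prefactor and with absolute `c`, the two-sided Gaussian tail is used with prefactor one,
and `B` is taken large in terms of `lam₀` (`exists_exp_add_le`). -/

/-! ### Elementary estimates for exponentials -/

/-- Products of complex numbers in the closed unit disc differ by at most the sum of the
differences of the factors. -/
theorem Finset.norm_prod_sub_prod_le {ι : Type*} (s : Finset ι) (f g : ι → ℂ)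
    (hf : ∀ i, ‖f i‖ ≤ 1) (hg : ∀ i, ‖g i‖ ≤ 1) :
    ‖∏ i ∈ s, f i - ∏ i ∈ s, g i‖ ≤ ∑ i ∈ s, ‖f i - g i‖ := by
  classical
  induction s using Finset.induction_on with
  | empty => simp
  | insert i s hi ih =>
    rw [Finset.prod_insert hi, Finset.prod_insert hi, Finset.sum_insert hi]
    have hgs : ‖∏ j ∈ s, g j‖ ≤ 1 := by
      rw [norm_prod]
      exact Finset.prod_le_one (fun j _ => norm_nonneg _) fun j _ => hg j
    calc ‖f i * ∏ j ∈ s, f j - g i * ∏ j ∈ s, g j‖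
        = ‖(f i - g i) * ∏ j ∈ s, g j + f i * (∏ j ∈ s, f j - ∏ j ∈ s, g j)‖ := by
          congr 1
          ring
      _ ≤ ‖f i - g i‖ * ‖∏ j ∈ s, g j‖ + ‖f i‖ * ‖∏ j ∈ s, f j - ∏ j ∈ s, g j‖ := by
          refine (norm_add_le _ _).trans ?_
          rw [norm_mul, norm_mul]
      _ ≤ ‖f i - g i‖ * 1 + 1 * ∑ j ∈ s, ‖f j - g j‖ := by
          gcongr
          exact hf i
      _ = _ := by ring

/-- Second-order Taylor bound for the complex exponential on the imaginary axis. -/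
theorem Complex.norm_exp_mul_I_sub_taylor_two_le (x : ℝ) :
    ‖Complex.exp (x * Complex.I) - (1 + x * Complex.I - (x : ℂ) ^ 2 / 2)‖ ≤ 4 * |x| ^ 3 := by
  have hn : ‖(x : ℂ) * Complex.I‖ = |x| := by simp
  rcases le_total |x| 1 with h | h
  · have h1 := Complex.exp_bound (x := x * Complex.I) (by rwa [hn]) (n := 3) (by norm_num)
    rw [hn] at h1
    have h2 : ∑ m ∈ Finset.range 3, ((x : ℂ) * Complex.I) ^ m / (m.factorial : ℂ)
        = 1 + x * Complex.I - (x : ℂ) ^ 2 / 2 := by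
      simp [Finset.sum_range_succ, Nat.factorial, mul_pow]
      ring
    rw [h2] at h1
    refine h1.trans ?_
    norm_num [Nat.factorial]
    nlinarith [pow_nonneg (abs_nonneg x) 3]
  -- For `|x| ≥ 1` no cancellation is needed: the terms add up to at most `2 + |x| + |x| ^ 2 / 2`,
  -- which is below `4 * |x| ^ 3`.
  · have h2 : ‖(1 : ℂ) + x * Complex.I - (x : ℂ) ^ 2 / 2‖ ≤ 1 + |x| + |x| ^ 2 / 2 := by
      refine (norm_sub_le _ _).trans (add_le_add ((norm_add_le _ _).trans ?_) ?_)
      · simp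
      · simp
    refine (norm_sub_le _ _).trans ?_
    rw [Complex.norm_exp_ofReal_mul_I]
    have h3 : |x| ≤ |x| ^ 2 := by nlinarith
    have h4 : |x| ^ 2 ≤ |x| ^ 3 := by nlinarith [sq_nonneg |x|]
    linarith

/-- A first-order bound for `exp` at `-y ^ 2 / 2`. -/
theorem Real.abs_exp_neg_sq_div_two_sub_le {y : ℝ} (hy : 0 ≤ y) :
    |Real.exp (-(y ^ 2 / 2)) - (1 - y ^ 2 / 2)| ≤ y ^ 3 := by
  have h0 : 0 ≤ y ^ 2 / 2 := by positivity
  have h1 := Real.one_sub_le_exp_neg (y ^ 2 / 2)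
  rw [abs_of_nonneg (by linarith)]
  -- From `y = 1 / 2` on, `y ^ 2 / 2 ≤ y ^ 3`, so there the trivial bound `exp ≤ 1` suffices.
  rcases le_total y (1 / 2) with h | h
  · have h2 : Real.exp (-(y ^ 2 / 2)) ≤ 1 / (1 + y ^ 2 / 2) := by
      rw [Real.exp_neg, ← one_div]
      exact one_div_le_one_div_of_le (by positivity) (by linarith [Real.add_one_le_exp (y ^ 2 / 2)])
    have h3 : 1 / (1 + y ^ 2 / 2) ≤ 1 - y ^ 2 / 2 + (y ^ 2 / 2) ^ 2 := by
      rw [div_le_iff₀ (by positivity)]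
      nlinarith [pow_nonneg h0 3]
    have h4 : (y ^ 2 / 2) ^ 2 ≤ y ^ 3 := by
      nlinarith [pow_nonneg hy 3]
    linarith
  · have h2 : Real.exp (-(y ^ 2 / 2)) ≤ 1 := Real.exp_le_one_iff.2 (by linarith)
    nlinarith [sq_nonneg y]

/-! ### Lyapunov's central limit theorem -/

namespace ProbabilityTheory

section CharFun

variable {Ω : Type*} [MeasurableSpace Ω] {P : Measure Ω} [IsProbabilityMeasure P] {X : Ω → ℝ}

theorem _root_.MeasureTheory.MemLp.integrable_abs_pow_three {μ : Measure Ω} (hX : MemLp X 3 μ) :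
    Integrable (fun w => |X w| ^ 3) μ := by
  have := hX.integrable_norm_pow (p := 3) (by norm_num)
  simpa using this

/-- Lyapunov's inequality between the second and the third absolute moment. -/
theorem sqrt_integral_sq_pow_three_le (hX : MemLp X 3 P) :
    √(∫ w, X w ^ 2 ∂P) ^ 3 ≤ ∫ w, |X w| ^ 3 ∂P := by
  set m := ∫ w, X w ^ 2 ∂P with hm
  have hm0 : 0 ≤ m := integral_nonneg fun w => sq_nonneg _
  have hs := Real.sq_sqrt hm0
  set s := √m
  have hs0 : 0 ≤ s := Real.sqrt_nonneg _
  have h2 : Integrable (fun w => X w ^ 2) P := (hX.mono_exponent (by norm_num)).integrable_sq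
  have h3 := hX.integrable_abs_pow_three
  -- The integrand on the left is the tangent line of `u ↦ u ^ (3 / 2)` at `u = s ^ 2`, taken at `u
  -- = X ^ 2`; its integral is `s ^ 3`.
  have key : ∫ w, (3 / 2 * s * X w ^ 2 - s ^ 3 / 2) ∂P ≤ ∫ w, |X w| ^ 3 ∂P := by
    refine integral_mono ((h2.const_mul _).sub (integrable_const _)) h3 fun w => ?_
    have h4 : 0 ≤ (|X w| - s) ^ 2 * (|X w| + s / 2) := by positivity
    have h5 := sq_abs (X w)
    simp only
    rw [← h5]
    nlinarith
  rw [integral_sub (h2.const_mul _) (integrable_const _), integral_const_mul, ← hm] at key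
  simp at key
  nlinarith

/-- Quantitative comparison of the characteristic function of a centred random variable with the
Gaussian one of the same variance. -/
theorem norm_charFun_map_sub_exp_le (hXm : AEMeasurable X P) (hX : MemLp X 3 P)
    (h0 : ∫ w, X w ∂P = 0) (t : ℝ) :
    ‖charFun (P.map X) t - Complex.exp (-((∫ w, X w ^ 2 ∂P : ℝ) * (t : ℂ) ^ 2 / 2))‖
      ≤ 5 * |t| ^ 3 * ∫ w, |X w| ^ 3 ∂P := by
  set m := ∫ w, X w ^ 2 ∂P with hm
  have hm0 : 0 ≤ m := integral_nonneg fun w => sq_nonneg _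
  have hi1 : Integrable X P := hX.integrable (by norm_num)
  have hi2 : Integrable (fun w => X w ^ 2) P := (hX.mono_exponent (by norm_num)).integrable_sq
  have hi3 := hX.integrable_abs_pow_three
  have hc1 : Integrable (fun w => ((t * X w : ℝ) : ℂ) * Complex.I) P :=
    ((hi1.const_mul t).ofReal).mul_const _
  have hc2 : Integrable (fun w => ((t * X w : ℝ) : ℂ) ^ 2 / 2) P := by
    have : Integrable (fun w => (((t ^ 2 / 2) * X w ^ 2 : ℝ) : ℂ)) P := (hi2.const_mul _).ofReal
    refine this.congr (ae_of_all _ fun w => ?_)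
    push_cast
    ring
  have hce : Integrable (fun w => Complex.exp (((t * X w : ℝ) : ℂ) * Complex.I)) P := by
    refine Integrable.of_bound (C := 1) ?_ (ae_of_all _ fun w => ?_)
    · exact (by fun_prop : AEMeasurable _ P).aestronglyMeasurable
    · rw [Complex.norm_exp_ofReal_mul_I]
  have hc3 : Integrable (fun w => 1 + ((t * X w : ℝ) : ℂ) * Complex.I) P :=
    (integrable_const _).add hc1
  have hc4 : Integrable
      (fun w => 1 + ((t * X w : ℝ) : ℂ) * Complex.I - ((t * X w : ℝ) : ℂ) ^ 2 / 2) P := hc3.sub hc2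
  have hchar : charFun (P.map X) t = ∫ w, Complex.exp (((t * X w : ℝ) : ℂ) * Complex.I) ∂P := by
    rw [charFun_apply_real, integral_map hXm (by fun_prop)]
    simp
  have hpoly : ∫ w, (1 + ((t * X w : ℝ) : ℂ) * Complex.I - ((t * X w : ℝ) : ℂ) ^ 2 / 2) ∂P
      = 1 - m * (t : ℂ) ^ 2 / 2 := by
    rw [integral_sub hc3 hc2, integral_add (integrable_const _) hc1,
      integral_mul_const, integral_complex_ofReal, integral_const_mul, h0]
    have : ∀ w, ((t * X w : ℝ) : ℂ) ^ 2 / 2 = (((t ^ 2 / 2) * X w ^ 2 : ℝ) : ℂ) := fun w => by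
      push_cast
      ring
    simp_rw [this]
    rw [integral_complex_ofReal, integral_const_mul, ← hm]
    simp
    ring
  have hA : ‖charFun (P.map X) t - (1 - m * (t : ℂ) ^ 2 / 2)‖ ≤ 4 * |t| ^ 3 * ∫ w, |X w| ^ 3 ∂P := by
    rw [hchar, ← hpoly, ← integral_sub hce hc4,
      ← integral_const_mul]
    refine norm_integral_le_of_norm_le (hi3.const_mul _) (ae_of_all _ fun w => ?_)
    refine (Complex.norm_exp_mul_I_sub_taylor_two_le (t * X w)).trans_eq ?_
    rw [abs_mul, mul_pow]
    ring
  -- The error here is of order `(√m * |t|) ^ 3`; Lyapunov's inequality turns it into a third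
  -- moment, and `4 + 1` gives the constant 5.
  have hB : ‖(1 - m * (t : ℂ) ^ 2 / 2) - Complex.exp (-((m : ℝ) * (t : ℂ) ^ 2 / 2))‖
      ≤ |t| ^ 3 * ∫ w, |X w| ^ 3 ∂P := by
    have h1 := Real.abs_exp_neg_sq_div_two_sub_le (y := √m * |t|) (by positivity)
    rw [mul_pow, mul_pow, sq_abs, Real.sq_sqrt hm0] at h1
    have h2 : (1 - m * (t : ℂ) ^ 2 / 2) - Complex.exp (-((m : ℝ) * (t : ℂ) ^ 2 / 2))
        = ((-(Real.exp (-(m * t ^ 2 / 2)) - (1 - m * t ^ 2 / 2)) : ℝ) : ℂ) := by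
      push_cast
      ring
    rw [h2, Complex.norm_real, Real.norm_eq_abs, abs_neg]
    refine h1.trans ?_
    rw [mul_comm]
    gcongr
    exact sqrt_integral_sq_pow_three_le hX
  calc _ ≤ _ := norm_sub_le_norm_sub_add_norm_sub _ (1 - m * (t : ℂ) ^ 2 / 2) _
    _ ≤ _ := add_le_add hA hB
    _ = _ := by ring

end CharFun

/-- **Lyapunov's central limit theorem** for triangular arrays with third moments. -/
theorem tendstoInDistribution_sum_of_lyapunov {Ω : Type*} [MeasurableSpace Ω]
    {P : Measure Ω} [IsProbabilityMeasure P] {ι : ℕ → Type*} [∀ k, Fintype (ι k)]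
    {X : (k : ℕ) → ι k → Ω → ℝ}
    (hmeas : ∀ k i, AEMeasurable (X k i) P) (hindep : ∀ k, iIndepFun (X k) P)
    (hX : ∀ k i, MemLp (X k i) 3 P) (h0 : ∀ k i, ∫ w, X k i w ∂P = 0)
    (hvar : Tendsto (fun k => ∑ i, ∫ w, X k i w ^ 2 ∂P) atTop (𝓝 1))
    (hlyap : Tendsto (fun k => ∑ i, ∫ w, |X k i w| ^ 3 ∂P) atTop (𝓝 0)) :
    TendstoInDistribution (fun k w => ∑ i, X k i w) atTop id (fun _ => P) (gaussianReal 0 1) where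
  forall_aemeasurable k := Finset.aemeasurable_fun_sum _ fun i _ => hmeas k i
  aemeasurable_limit := aemeasurable_id
  tendsto := by
    refine ProbabilityMeasure.tendsto_iff_tendsto_charFun.2 fun t => ?_
    simp only [ProbabilityMeasure.coe_mk, Measure.map_id, charFun_gaussianReal]
    have hprod : ∀ k, charFun (P.map fun w => ∑ i, X k i w) t
        = ∏ i, charFun (P.map (X k i)) t := fun k => by
      rw [(hindep k).charFun_map_fun_sum_eq_prod (hmeas k), Finset.prod_apply]
    simp_rw [hprod]
    -- The comparison is with the Gaussian of the actual variance `V k`, which factors over the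
    -- summands; `V k → 1` enters separately.
    set V : ℕ → ℝ := fun k => ∑ i, ∫ w, X k i w ^ 2 ∂P with hV
    have hgauss : Tendsto (fun k => Complex.exp (-((V k : ℝ) * (t : ℂ) ^ 2 / 2))) atTop
        (𝓝 (Complex.exp (t * (0 : ℝ) * Complex.I - ((1 : NNReal) : ℝ) * (t : ℂ) ^ 2 / 2))) := by
      have : Tendsto (fun k => (V k : ℂ)) atTop (𝓝 ((1 : ℝ) : ℂ)) :=
        (Complex.continuous_ofReal.tendsto _).comp hvar
      have h2 := (Complex.continuous_exp.tendsto _).comp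
        (((this.mul_const ((t : ℂ) ^ 2)).div_const 2).neg)
      refine h2.trans (le_of_eq ?_)
      simp
    have hdiff : Tendsto (fun k => (∏ i, charFun (P.map (X k i)) t)
        - Complex.exp (-((V k : ℝ) * (t : ℂ) ^ 2 / 2))) atTop (𝓝 0) := by
      refine squeeze_zero_norm (a := fun k => 5 * |t| ^ 3 * ∑ i, ∫ w, |X k i w| ^ 3 ∂P)
        (fun k => ?_) (by simpa using hlyap.const_mul (5 * |t| ^ 3))
      have hexp : Complex.exp (-((V k : ℝ) * (t : ℂ) ^ 2 / 2))
          = ∏ i, Complex.exp (-((∫ w, X k i w ^ 2 ∂P : ℝ) * (t : ℂ) ^ 2 / 2)) := by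
        rw [← Complex.exp_sum, hV]
        push_cast
        rw [Finset.sum_neg_distrib, Finset.sum_mul, Finset.sum_div]
      rw [hexp]
      refine (Finset.norm_prod_sub_prod_le _ _ _ (fun i => ?_) fun i => ?_).trans ?_
      · have := Measure.isProbabilityMeasure_map (hmeas k i)
        exact norm_charFun_le_one t
      · have : -((∫ w, X k i w ^ 2 ∂P : ℝ) * (t : ℂ) ^ 2 / 2)
            = ((-((∫ w, X k i w ^ 2 ∂P) * t ^ 2 / 2) : ℝ) : ℂ) := by
          push_cast
          ring
        rw [this, Complex.norm_exp_ofReal, Real.exp_le_one_iff]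
        have : 0 ≤ ∫ w, X k i w ^ 2 ∂P := integral_nonneg fun w => sq_nonneg _
        have : 0 ≤ (∫ w, X k i w ^ 2 ∂P) * t ^ 2 / 2 := by positivity
        linarith
      · rw [Finset.mul_sum]
        exact Finset.sum_le_sum fun i _ => norm_charFun_map_sub_exp_le (hmeas k i) (hX k i) (h0 k i) t
    simpa using hdiff.add hgauss

/-! ### Gaussian tails, uniformly in the threshold -/

/-- The standard Gaussian tail bound with the sharp constant at zero. -/
theorem gaussianReal_setOf_le_abs_le {t : ℝ} (ht : 0 ≤ t) :
    (gaussianReal 0 1).real {x | t ≤ |x|} ≤ Real.exp (-(t ^ 2 / 2)) := by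
  have hna : NullSingletonClass (gaussianReal 0 1) := nullSingletonClass_gaussianReal one_ne_zero
  -- Translate by `s`: for `x > 0`, `(x + s) ^ 2 ≥ x ^ 2 + s ^ 2`. Each tail thus keeps the factor
  -- `P(N > 0) = 1 / 2`, and the two together have prefactor one.
  have hshift : ∀ s : ℝ, 0 ≤ s → (gaussianReal 0 1) (Set.Ici s)
      ≤ ENNReal.ofReal (Real.exp (-(s ^ 2 / 2))) * (gaussianReal 0 1) (Set.Ioi 0) := by
    intro s hs
    rw [← Ioi_ae_eq_Ici.measure_eq, gaussianReal_apply 0 one_ne_zero,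
      gaussianReal_apply 0 one_ne_zero, ← lintegral_const_mul _ (measurable_gaussianPDF _ _)]
    rw [← lintegral_indicator measurableSet_Ioi, ← lintegral_indicator measurableSet_Ioi,
      ← lintegral_add_right_eq_self _ s]
    refine lintegral_mono fun x => ?_
    by_cases hx : 0 < x
    · rw [Set.indicator_of_mem (by simpa using hx), Set.indicator_of_mem (by simpa using hx),
        gaussianPDF, gaussianPDF, ← ENNReal.ofReal_mul (Real.exp_nonneg _)]
      refine ENNReal.ofReal_le_ofReal ?_
      simp only [gaussianPDFReal]
      rw [mul_left_comm, ← Real.exp_add]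
      gcongr
      simp
      nlinarith
    · rw [Set.indicator_of_notMem (by simpa using hx)]
      exact bot_le
  have hneg : ∀ s : ℝ, (gaussianReal 0 1) (Set.Iic (-s)) = (gaussianReal 0 1) (Set.Ici s) := by
    intro s
    have h1 : (gaussianReal 0 1).map (fun x => -x) = gaussianReal 0 1 := by
      simpa using gaussianReal_map_neg (μ := 0) (v := 1)
    conv_lhs => rw [← h1]
    rw [Measure.map_apply measurable_neg measurableSet_Iic]
    congr 1
    ext x
    simp
  have hset : {x : ℝ | t ≤ |x|} = Set.Iic (-t) ∪ Set.Ici t := by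
    ext x
    simp only [Set.mem_ofPred_eq, Set.mem_union, Set.mem_Iic, Set.mem_Ici, le_abs]
    constructor <;> rintro (h | h) <;> [right; left; right; left] <;> linarith
  have htot : (gaussianReal 0 1) (Set.Ioi 0) + (gaussianReal 0 1) (Set.Ioi 0) = 1 := by
    have h1 : (gaussianReal 0 1) (Set.Iic 0) = (gaussianReal 0 1) (Set.Ioi 0) := by
      rw [Ioi_ae_eq_Ici.measure_eq, ← hneg 0, neg_zero]
    conv_lhs => enter [1]; rw [← h1]
    rw [← measure_union (Set.Iic_disjoint_Ioi le_rfl) measurableSet_Ioi, Set.Iic_union_Ioi,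
      measure_univ]
  have hfin : (gaussianReal 0 1) {x | t ≤ |x|} ≤ ENNReal.ofReal (Real.exp (-(t ^ 2 / 2))) := by
    rw [hset]
    refine (measure_union_le _ _).trans ?_
    rw [hneg]
    refine (add_le_add (hshift t ht) (hshift t ht)).trans ?_
    rw [← mul_add, htot, mul_one]
  exact ENNReal.toReal_le_of_le_ofReal (Real.exp_nonneg _) hfin

/-- If `T k` converges in distribution to a standard Gaussian variable, then its tail
probabilities are asymptotically bounded by the Gaussian ones. -/
theorem eventually_real_tail_le {Ω : Type*} [MeasurableSpace Ω] {P : Measure Ω}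
    [IsProbabilityMeasure P] {T : ℕ → Ω → ℝ}
    (hT : TendstoInDistribution T atTop id (fun _ => P) (gaussianReal 0 1))
    {t : ℝ} (ht : 0 ≤ t) {η : ℝ} (hη : 0 < η) :
    ∀ᶠ k in atTop, P.real {w | t ≤ |T k w|} ≤ Real.exp (-(t ^ 2 / 2)) + η := by
  have hcl : IsClosed {x : ℝ | t ≤ |x|} := isClosed_le continuous_const continuous_abs
  have h1 := ProbabilityMeasure.limsup_measure_closed_le_of_tendsto hT.tendsto hcl
  simp only [ProbabilityMeasure.coe_mk, Measure.map_id] at h1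
  have h2 := gaussianReal_setOf_le_abs_le ht
  have h3 : (gaussianReal 0 1) {x | t ≤ |x|} < ENNReal.ofReal (Real.exp (-(t ^ 2 / 2)) + η) := by
    rw [ENNReal.lt_ofReal_iff_toReal_lt (measure_ne_top _ _)]
    exact h2.trans_lt (by linarith)
  filter_upwards [Filter.eventually_lt_of_limsup_lt (h1.trans_lt h3)] with k hk
  rw [Measure.map_apply_of_aemeasurable (hT.forall_aemeasurable k) hcl.measurableSet] at hk
  exact ENNReal.toReal_le_of_le_ofReal (by positivity) hk.le

end ProbabilityTheory

/-- Antitone functions that are asymptotically dominated pointwise by a continuous function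
vanishing at infinity are asymptotically dominated uniformly on closed half-lines. -/
theorem eventually_forall_ge_le_add {f : ℕ → ℝ → ℝ} {g : ℝ → ℝ} {a b : ℝ} (hab : a < b)
    (hf : ∀ k, Antitone (f k)) (hg : Continuous g) (hg0 : ∀ t, 0 ≤ g t)
    (hginf : Tendsto g atTop (𝓝 0))
    (hfg : ∀ t, a ≤ t → ∀ η > 0, ∀ᶠ k in atTop, f k t ≤ g t + η) {η : ℝ} (hη : 0 < η) :
    ∀ᶠ k in atTop, ∀ t, b ≤ t → f k t ≤ g t + η := by
  obtain ⟨M, hM, hMb⟩ := ((hginf.eventually (gt_mem_nhds (half_pos hη))).and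
    (eventually_ge_atTop b)).exists
  have hcompact : ∀ᶠ k in atTop, ∀ t ∈ Set.Icc b M, f k t ≤ g t + η := by
    have hloc : ∀ t ∈ Set.Icc b M, ∃ U ∈ 𝓝 t, ∀ᶠ k in atTop, ∀ s ∈ U, f k s ≤ g s + η := by
      intro t ht
      obtain ⟨δ, hδ, hball⟩ := Metric.continuousAt_iff.1 hg.continuousAt (η / 3) (by positivity)
      -- On the ball around `t`, monotonicity bounds `f k s` by the value at the left end `t - r`;
      -- `r ≤ b - a` keeps that point where the pointwise bound is available.
      set r := min (δ / 2) (b - a)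
      have hr : 0 < r := lt_min (half_pos hδ) (sub_pos.2 hab)
      have hrδ : r < δ := (min_le_left _ _).trans_lt (half_lt_self hδ)
      have hrb : r ≤ b - a := min_le_right _ _
      refine ⟨Metric.ball t r, Metric.ball_mem_nhds t hr, ?_⟩
      filter_upwards [hfg (t - r) (by linarith [ht.1]) (η / 3) (by positivity)] with k hk s hs
      rw [Metric.mem_ball, Real.dist_eq] at hs
      have h1 := hball (x := t - r) (by
        rw [Real.dist_eq, sub_sub_cancel_left, abs_neg, abs_of_pos hr]
        exact hrδ)
      have h2 := hball (x := s) (by rw [Real.dist_eq]; exact hs.trans hrδ)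
      rw [Real.dist_eq] at h1 h2
      have h3 := hf k (show t - r ≤ s by linarith [(abs_lt.1 hs).1])
      linarith [(abs_lt.1 h1).2, (abs_lt.1 h2).1]
    choose! U hU hev using hloc
    obtain ⟨S, hS, hcov⟩ := isCompact_Icc.elim_nhds_subcover U hU
    filter_upwards [(Filter.eventually_all_finset S).2 fun t ht => hev t (hS t ht)] with k hk s hs
    obtain ⟨t, ht, hst⟩ := Set.mem_iUnion₂.1 (hcov hs)
    exact hk t ht s hst
  filter_upwards [hcompact, hfg M (hab.le.trans hMb) (η / 2) (half_pos hη)] with k hk hkM t ht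
  rcases le_total t M with h | h
  · exact hk t ⟨ht, h⟩
  -- Beyond `M` the value at `M` already lies below `η`.
  · linarith [hf k h, hg0 t]

/-! ### The deterministic loss bound -/

namespace AnchoredThresholding

/-- Both `d` and the thresholded value lie within `r` of `x`, whence `2 * r`; the thresholded value
has the least absolute value among such points, whence `2 * |d|`. -/
theorem abs_softThreshold_sub_le {r x d : ℝ} (h : |d - x| ≤ r) :
    |softThreshold r x - d| ≤ 2 * r ∧ |softThreshold r x - d| ≤ 2 * |d| := by
  obtain ⟨h1, h2⟩ := (softThreshold_eq_iff ((abs_nonneg _).trans h) _).1 (Eq.refl (softThreshold r x))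
  constructor
  · have := abs_sub_le (softThreshold r x) x d
    rw [abs_sub_comm x d] at this
    linarith
  · have := abs_sub (softThreshold r x) d
    linarith [h2 d h]

set_option maxHeartbeats 800000 in
/-- The loss bound on the event on which all estimation errors are controlled, as a function of the
variances `vc`, `vo` and their estimates `p`, `q`. -/
theorem sq_weighted_error_le {κ lam₀ B vc vo p q D Dbar U W lam : ℝ} (hκ : 0 < κ) (hlam₀ : 0 < lam₀)
    (hvc : 0 < vc) (hvo : 0 < vo) (hκv : κ * vo ≤ vc) (hp : vc / 4 ≤ p) (hp' : p ≤ 4 * vc)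
    (hq : vo / 4 ≤ q) (hq' : q ≤ 4 * vo) (hD : |D| ≤ Dbar) (hlam : lam₀ ≤ lam)
    (hU : U ^ 2 ≤ B ^ 2 * lam ^ 2 * vc) (hW : W ^ 2 ≤ B ^ 2 * lam ^ 2 * vo)
    (hUW : |U - W| ≤ lam / 2 * √(vc + vo)) :
    ((1 - p / (p + q)) * U
        + p / (p + q) * (W + (softThreshold (lam * √(p + q)) (D + U - W) - D))) ^ 2
      ≤ 3 * (16 * B ^ 2 + B ^ 2 * (1 + 1 / κ) + (4 / lam₀ ^ 2 + 16 * (1 + 1 / κ)))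
        * (lam ^ 2 * (vc * vo / (vc + vo) + min vc (Dbar ^ 2))) := by
  have hp0 : 0 < p := by linarith
  have hq0 : 0 < q := by linarith
  have hl : 0 < lam := hlam₀.trans_le hlam
  have hD0 : 0 ≤ Dbar := (abs_nonneg _).trans hD
  have hvo' : vo ≤ vc / κ := by rw [le_div_iff₀ hκ]; linarith
  have hsum : vc + vo ≤ (1 + 1 / κ) * vc := by
    have : (1 + 1 / κ) * vc = vc + vc / κ := by ring
    linarith
  set R := vc * vo / (vc + vo) with hR
  have hR0 : 0 < R := by positivity
  -- The only obstacle to `vo ≲ R` would be `vo` much larger than `vc`, which `κ` excludes.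
  have hRo : vo ≤ (1 + 1 / κ) * R := by
    rw [hR, mul_div_assoc', le_div_iff₀ (by positivity)]
    nlinarith
  set m := min vc (Dbar ^ 2) with hm
  have hm0 : 0 ≤ m := le_min hvc.le (sq_nonneg _)
  set ω := p / (p + q) with hω
  have hω0 : 0 ≤ ω := by positivity
  have hω1 : 0 ≤ 1 - ω := by
    rw [hω, one_sub_div (by positivity)]
    simp only [add_sub_cancel_left]
    positivity
  -- `16 = 4 * 4`: one factor from `q ≤ 4 * vo`, one from `vc + vo ≤ 4 * (p + q)`.
  have hωvc : (1 - ω) * vc ≤ 16 * R := by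
    rw [hω, one_sub_div (by positivity), add_sub_cancel_left, hR, div_mul_eq_mul_div,
      mul_div_assoc', div_le_div_iff₀ (by positivity) (by positivity)]
    have h1 : q * (vc + vo) ≤ (4 * vo) * (4 * (p + q)) :=
      mul_le_mul hq' (by linarith) (by positivity) (by positivity)
    nlinarith
  set d := softThreshold (lam * √(p + q)) (D + U - W)
  -- This factor 2 cancels the `1 / 2` in `hUW`, so the true bias is within the estimated threshold.
  have hsqrt : √(vc + vo) ≤ 2 * √(p + q) := by
    rw [Real.sqrt_le_left (by positivity), mul_pow, Real.sq_sqrt (by positivity)]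
    linarith
  have hclose : |D - (D + U - W)| ≤ lam * √(p + q) := by
    have : D - (D + U - W) = -(U - W) := by ring
    rw [this, abs_neg]
    nlinarith
  obtain ⟨hd1, hd2⟩ := abs_softThreshold_sub_le hclose
  have hd1' : (d - D) ^ 2 ≤ 16 * (1 + 1 / κ) * lam ^ 2 * vc := by
    rw [← sq_abs]
    calc |d - D| ^ 2 ≤ (2 * (lam * √(p + q))) ^ 2 := by gcongr
      _ = 4 * lam ^ 2 * (p + q) := by
        rw [mul_pow, mul_pow, Real.sq_sqrt (by positivity)]
        ring
      _ ≤ 4 * lam ^ 2 * (4 * ((1 + 1 / κ) * vc)) := by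
        gcongr
        linarith
      _ = _ := by ring
  have hd2' : (d - D) ^ 2 ≤ 4 / lam₀ ^ 2 * lam ^ 2 * Dbar ^ 2 := by
    rw [← sq_abs]
    -- The bound by the bias carries no factor `lam`; `lam ≥ lam₀` supplies it at the cost of `1 /
    -- lam₀ ^ 2`.
    have h1 : 1 ≤ lam ^ 2 / lam₀ ^ 2 := by
      rw [one_le_div (by positivity)]
      gcongr
    calc |d - D| ^ 2 ≤ (2 * Dbar) ^ 2 := by
          gcongr
          linarith
      _ = 4 * 1 * Dbar ^ 2 := by ring
      _ ≤ 4 * (lam ^ 2 / lam₀ ^ 2) * Dbar ^ 2 := by gcongr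
      _ = _ := by ring
  have hd : (d - D) ^ 2 ≤ (4 / lam₀ ^ 2 + 16 * (1 + 1 / κ)) * lam ^ 2 * m := by
    have e1 : 0 ≤ 4 / lam₀ ^ 2 := by positivity
    have e2 : 0 ≤ 16 * (1 + 1 / κ) := by positivity
    rw [hm, mul_min_of_nonneg _ _ (by positivity)]
    refine le_min (hd1'.trans ?_) (hd2'.trans ?_)
    · gcongr
      linarith
    · gcongr
      linarith
  have hU' : ((1 - ω) * U) ^ 2 ≤ 16 * B ^ 2 * lam ^ 2 * R := by
    calc ((1 - ω) * U) ^ 2 = (1 - ω) * (1 - ω) * U ^ 2 := by ring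
      _ ≤ 1 * (1 - ω) * (B ^ 2 * lam ^ 2 * vc) := by
        gcongr
        linarith
      _ = B ^ 2 * lam ^ 2 * ((1 - ω) * vc) := by ring
      _ ≤ B ^ 2 * lam ^ 2 * (16 * R) := by gcongr
      _ = _ := by ring
  have hshrink : ∀ x : ℝ, (ω * x) ^ 2 ≤ x ^ 2 := fun x => by
    rw [mul_pow]
    exact mul_le_of_le_one_left (sq_nonneg x) (pow_le_one₀ hω0 (by linarith))
  have hW' : (ω * W) ^ 2 ≤ B ^ 2 * (1 + 1 / κ) * lam ^ 2 * R := by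
    calc (ω * W) ^ 2 ≤ W ^ 2 := hshrink W
      _ ≤ B ^ 2 * lam ^ 2 * ((1 + 1 / κ) * R) := hW.trans (by gcongr)
      _ = _ := by ring
  have hd' := (hshrink (d - D)).trans hd
  have hthree : ∀ x y z : ℝ, (x + (y + z)) ^ 2 ≤ 3 * (x ^ 2 + y ^ 2 + z ^ 2) := fun x y z => by
    nlinarith [sq_nonneg (x - y), sq_nonneg (x - z), sq_nonneg (y - z)]
  rw [mul_add ω]
  refine (hthree _ _ _).trans ?_
  have hκ1 : 0 < 1 / κ := by positivity
  -- The cross terms created by multiplying the summed constants with `R + m` are nonnegative and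
  -- can be dropped.
  have hk1 : 0 ≤ 16 * B ^ 2 * lam ^ 2 * m := by positivity
  have hk2 : 0 ≤ B ^ 2 * (1 + 1 / κ) * lam ^ 2 * m := by positivity
  have hk3 : 0 ≤ (4 / lam₀ ^ 2 + 16 * (1 + 1 / κ)) * lam ^ 2 * R := by positivity
  linarith

/-- A constant `B` for which the tails of the three standardized errors add up to a Gaussian tail. -/
theorem exists_exp_add_le {a : ℝ} (ha : 0 < a) : ∃ B : ℝ, 0 < B ∧ ∀ s, a ≤ s →
    Real.exp (-((s / 2) ^ 2 / 2)) + 2 * Real.exp (-((B * s) ^ 2 / 2))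
      ≤ Real.exp (-(1 / 16) * s ^ 2) := by
  set x₀ := a ^ 2 / 16 with hx₀
  have hx0 : 0 < x₀ := by positivity
  -- With `x = s ^ 2 / 16` and `B ^ 2 = (1 + M) / 8` the claim, divided by `exp (-x)`, is `exp (-x)
  -- + 2 * exp (-(M * x)) ≤ 1`. By `exp (-y) ≤ 1 / (1 + y)` it follows from `2 + x ≤ M * x ^ 2`,
  -- which this `M` ensures for `x ≥ x₀`.
  set M := 2 / x₀ ^ 2 + 1 / x₀ with hM
  have hM0 : 0 < M := by positivity
  refine ⟨√((1 + M) / 8), by positivity, fun s hs => ?_⟩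
  set x := s ^ 2 / 16 with hx
  have hxx : x₀ ≤ x := by
    rw [hx, hx₀]
    gcongr
  have hxpos : 0 < x := hx0.trans_le hxx
  have e1 : -((s / 2) ^ 2 / 2) = -x + -x := by rw [hx]; ring
  have e2 : -((√((1 + M) / 8) * s) ^ 2 / 2) = -x + -(M * x) := by
    rw [mul_pow, Real.sq_sqrt (by positivity), hx]
    ring
  have e3 : -(1 / 16) * s ^ 2 = -x := by rw [hx]; ring
  have hinv : ∀ y : ℝ, 0 < y → Real.exp (-y) ≤ 1 / (1 + y) := fun y hy => by
    rw [Real.exp_neg, ← one_div]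
    exact one_div_le_one_div_of_le (by positivity) (by linarith [Real.add_one_le_exp y])
  have hkey : 1 / (1 + x) + 2 * (1 / (1 + M * x)) ≤ 1 := by
    have h1 : 2 ≤ 2 / x₀ ^ 2 * x ^ 2 := by
      rw [div_mul_eq_mul_div, le_div_iff₀ (by positivity)]
      gcongr
    have h2 : x ≤ 1 / x₀ * x ^ 2 := by
      rw [div_mul_eq_mul_div, le_div_iff₀ (by positivity)]
      nlinarith
    have h3 : 2 + x ≤ M * x ^ 2 := by rw [hM, add_mul]; linarith
    have hMx : 0 < M * x := by positivity
    rw [mul_one_div, div_add_div _ _ (by positivity) (by positivity), div_le_one (by positivity)]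
    nlinarith
  rw [e1, e2, e3, Real.exp_add, Real.exp_add]
  calc Real.exp (-x) * Real.exp (-x) + 2 * (Real.exp (-x) * Real.exp (-(M * x)))
      = Real.exp (-x) * (Real.exp (-x) + 2 * Real.exp (-(M * x))) := by ring
    _ ≤ Real.exp (-x) * 1 := by
        gcongr
        linarith [hinv x hxpos, hinv (M * x) (by positivity)]
    _ = _ := mul_one _

/-! ### Asymptotic normality of the estimation errors -/

section CLT

variable {Ω : Type u} {𝒳 : Type v} [MeasurableSpace Ω] [MeasurableSpace 𝒳]
  {P : Measure Ω} [IsProbabilityMeasure P] {nc no : ℕ → ℕ} {Qc Qo : ℕ → Measure (Record 𝒳)}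
  {Zc : (k : ℕ) → Fin (nc k) → Ω → Record 𝒳} {Zo : (k : ℕ) → Fin (no k) → Ω → Record 𝒳}
  {βstar βo : ℕ → ℝ} {ψc ψo : ℕ → Record 𝒳 → ℝ} {σc σo ρc ρo : ℝ} {βhatc βhato : ℕ → Ω → ℝ}

/-- Every linear combination, with coefficients of unit Euclidean norm, of the two standardized
estimators is asymptotically standard normal. -/
theorem tendstoInDistribution_combination
    (hn : Tendsto (fun k => min (nc k) (no k)) atTop atTop)
    (hZ : IndependentSamples P nc no Qc Qo Zc Zo) (hσc : 0 < σc) (hσo : 0 < σo)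
    (hmc : ∀ k, Measurable (βhatc k)) (hmo : ∀ k, Measurable (βhato k))
    (hc : AsymptoticallyLinear P nc Qc Zc βhatc βstar ψc σc ρc)
    (ho : AsymptoticallyLinear P no Qo Zo βhato βo ψo σo ρo)
    {θ η : ℕ → ℝ} (hθη : ∀ᶠ k in atTop, θ k ^ 2 + η k ^ 2 = 1) :
    TendstoInDistribution
      (fun k w => θ k * (√(nc k : ℝ) * (βhatc k w - βstar k) / σc)
        + η k * (√(no k : ℝ) * (βhato k w - βo k) / σo))
      atTop id (fun _ => P) (gaussianReal 0 1) := by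
  have hnc : Tendsto (fun k => √(nc k : ℝ)) atTop atTop :=
    Real.tendsto_sqrt_atTop.comp (tendsto_natCast_atTop_atTop.comp
      (tendsto_atTop_mono (fun k => min_le_left _ _) hn))
  have hno : Tendsto (fun k => √(no k : ℝ)) atTop atTop :=
    Real.tendsto_sqrt_atTop.comp (tendsto_natCast_atTop_atTop.comp
      (tendsto_atTop_mono (fun k => min_le_right _ _) hn))
  -- Both samples form one independent array, scaled so that the variances add up to `θ ^ 2 + η ^
  -- 2`.
  set g : (k : ℕ) → Fin (nc k) ⊕ Fin (no k) → Record 𝒳 → ℝ := fun k =>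
    Sum.elim (fun _ z => θ k / (σc * √(nc k : ℝ)) * ψc k z)
      (fun _ z => η k / (σo * √(no k : ℝ)) * ψo k z) with hg
  have hgm : ∀ k i, Measurable (g k i) := fun k i => by
    rcases i with i | i
    · exact (hc.measurable_influence k).const_mul _
    · exact (ho.measurable_influence k).const_mul _
  set Z : (k : ℕ) → Fin (nc k) ⊕ Fin (no k) → Ω → Record 𝒳 := fun k =>
    Sum.elim (Zc k) (Zo k) with hZdef
  have hZm : ∀ k i, Measurable (Z k i) := fun k i => by
    rcases i with i | i
    · exact hZ.measurable_rct k i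
    · exact hZ.measurable_obs k i
  have hmean : ∀ k i (f : Record 𝒳 → ℝ), Measurable f →
      ∫ w, f (Z k (.inl i) w) ∂P = ∫ z, f z ∂(Qc k) := fun k i f hf => by
    rw [← hZ.law_rct k i, integral_map (hZ.measurable_rct k i).aemeasurable
      hf.aestronglyMeasurable]
    rfl
  have hmean' : ∀ k i (f : Record 𝒳 → ℝ), Measurable f →
      ∫ w, f (Z k (.inr i) w) ∂P = ∫ z, f z ∂(Qo k) := fun k i f hf => by
    rw [← hZ.law_obs k i, integral_map (hZ.measurable_obs k i).aemeasurable
      hf.aestronglyMeasurable]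
    rfl
  have hpos : ∀ᶠ k in atTop, 0 < √(nc k : ℝ) ∧ 0 < √(no k : ℝ) ∧ θ k ^ 2 + η k ^ 2 = 1 := by
    filter_upwards [hnc.eventually_gt_atTop 0, hno.eventually_gt_atTop 0, hθη] with k h1 h2 h3
    exact ⟨h1, h2, h3⟩
  have hclt : TendstoInDistribution (fun k w => ∑ i, g k i (Z k i w)) atTop id
      (fun _ => P) (gaussianReal 0 1) := by
    refine tendstoInDistribution_sum_of_lyapunov (X := fun k i w => g k i (Z k i w))
      (fun k i => ((hgm k i).comp (hZm k i)).aemeasurable) (fun k => (hZ.indep k).comp _ (hgm k))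
      ?_ ?_ ?_ ?_
    · rintro k (i | i)
      · have h3 := hc.third_moment_finite k
        rw [← hZ.law_rct k i] at h3
        exact (h3.comp_of_map (hZ.measurable_rct k i).aemeasurable).const_mul _
      · have h3 := ho.third_moment_finite k
        rw [← hZ.law_obs k i] at h3
        exact (h3.comp_of_map (hZ.measurable_obs k i).aemeasurable).const_mul _
    · rintro k (i | i)
      · rw [hmean k i _ (hgm k _)]
        simp only [hg, Sum.elim_inl, integral_const_mul, hc.mean_zero, mul_zero]
      · rw [hmean' k i _ (hgm k _)]
        simp only [hg, Sum.elim_inr, integral_const_mul, ho.mean_zero, mul_zero]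
    · refine tendsto_const_nhds.congr' ?_
      filter_upwards [hpos] with k ⟨h1, h2, h3⟩
      have e1 := Real.sq_sqrt (Nat.cast_nonneg (α := ℝ) (nc k))
      have e2 := Real.sq_sqrt (Nat.cast_nonneg (α := ℝ) (no k))
      rw [Fintype.sum_sum_type]
      simp_rw [fun i => hmean k i (fun z => g k (.inl i) z ^ 2) ((hgm k _).pow_const 2),
        fun i => hmean' k i (fun z => g k (.inr i) z ^ 2) ((hgm k _).pow_const 2)]
      simp only [hg, Sum.elim_inl, Sum.elim_inr, mul_pow, integral_const_mul, hc.second_moment,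
        ho.second_moment, Finset.sum_const, Finset.card_univ, Fintype.card_fin, nsmul_eq_mul,
        div_pow]
      have n1 : (nc k : ℝ) ≠ 0 := by rw [← e1]; positivity
      have n2 : (no k : ℝ) ≠ 0 := by rw [← e2]; positivity
      rw [← h3, e1, e2]
      field_simp
    -- Each sample contributes at most `n * ρ / (σ ^ 3 * n ^ (3 / 2))`, which vanishes because `σ`
    -- and `ρ` are the same at every stage.
    · have hlim : Tendsto (fun k => (ρc / σc ^ 3) / √(nc k : ℝ) + (ρo / σo ^ 3) / √(no k : ℝ))
          atTop (𝓝 0) := by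
        simpa using (hnc.const_div_atTop (ρc / σc ^ 3)).add (hno.const_div_atTop (ρo / σo ^ 3))
      refine squeeze_zero' (Eventually.of_forall fun k => Finset.sum_nonneg fun i _ =>
        integral_nonneg fun w => by positivity) ?_ hlim
      filter_upwards [hpos] with k ⟨h1, h2, h3⟩
      have e1 := Real.sq_sqrt (Nat.cast_nonneg (α := ℝ) (nc k))
      have e2 := Real.sq_sqrt (Nat.cast_nonneg (α := ℝ) (no k))
      have hρc : 0 ≤ ρc := hc.third_moment k ▸ integral_nonneg fun z => by positivity
      have hρo : 0 ≤ ρo := ho.third_moment k ▸ integral_nonneg fun z => by positivity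
      have hθ : |θ k| ^ 3 ≤ 1 := pow_le_one₀ (abs_nonneg _)
        ((sq_le_one_iff_abs_le_one _).1 (by linarith [sq_nonneg (η k)]))
      have hη : |η k| ^ 3 ≤ 1 := pow_le_one₀ (abs_nonneg _)
        ((sq_le_one_iff_abs_le_one _).1 (by linarith [sq_nonneg (θ k)]))
      rw [Fintype.sum_sum_type]
      simp_rw [fun i => hmean k i (fun z => |g k (.inl i) z| ^ 3) ((hgm k _).abs.pow_const 3),
        fun i => hmean' k i (fun z => |g k (.inr i) z| ^ 3) ((hgm k _).abs.pow_const 3)]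
      simp only [hg, Sum.elim_inl, Sum.elim_inr, abs_mul, abs_div, mul_pow, integral_const_mul,
        hc.third_moment, ho.third_moment, Finset.sum_const, Finset.card_univ, Fintype.card_fin,
        nsmul_eq_mul, div_pow, abs_of_pos hσc, abs_of_pos hσo, abs_of_pos h1, abs_of_pos h2]
      refine add_le_add ?_ ?_
      · calc (nc k : ℝ) * (|θ k| ^ 3 / (σc ^ 3 * √(nc k : ℝ) ^ 3) * ρc)
            ≤ √(nc k : ℝ) ^ 2 * (1 / (σc ^ 3 * √(nc k : ℝ) ^ 3) * ρc) := by
              rw [e1]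
              gcongr
          _ = _ := by field_simp
      · calc (no k : ℝ) * (|η k| ^ 3 / (σo ^ 3 * √(no k : ℝ) ^ 3) * ρo)
            ≤ √(no k : ℝ) ^ 2 * (1 / (σo ^ 3 * √(no k : ℝ) ^ 3) * ρo) := by
              rw [e2]
              gcongr
          _ = _ := by field_simp
  -- Slutsky's lemma: the remainders of the two linear expansions enter with coefficients of
  -- absolute value at most `1 / σc` and `1 / σo`.
  refine tendstoInDistribution_of_tendstoInMeasure_sub _ _ hclt ?_ fun k => by fun_prop
  rw [tendstoInMeasure_iff_norm]
  intro ε hε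
  have h1 := tendstoInMeasure_iff_norm.1 hc.expansion (ε * σc / 2) (by positivity)
  have h2 := tendstoInMeasure_iff_norm.1 ho.expansion (ε * σo / 2) (by positivity)
  have h12 := h1.add h2
  rw [add_zero] at h12
  refine tendsto_of_tendsto_of_tendsto_of_le_of_le' tendsto_const_nhds h12
    (Eventually.of_forall fun k => bot_le) ?_
  filter_upwards [hpos] with k ⟨p1, p2, p3⟩
  refine (measure_mono fun w hw => ?_).trans (measure_union_le _ _)
  have hθ : |θ k| ≤ 1 := (sq_le_one_iff_abs_le_one _).1 (by linarith [sq_nonneg (η k)])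
  have hη : |η k| ≤ 1 := (sq_le_one_iff_abs_le_one _).1 (by linarith [sq_nonneg (θ k)])
  by_contra hcon
  simp only [Set.mem_union, Set.mem_ofPred_eq, not_or, not_le, sub_zero, Real.norm_eq_abs] at hcon hw
  obtain ⟨c1, c2⟩ := hcon
  set rc := √(nc k : ℝ) * (βhatc k w - βstar k) - 1 / √(nc k : ℝ) * ∑ i, ψc k (Zc k i w)
  set ro := √(no k : ℝ) * (βhato k w - βo k) - 1 / √(no k : ℝ) * ∑ i, ψo k (Zo k i w)
  have hdec : (θ k * (√(nc k : ℝ) * (βhatc k w - βstar k) / σc)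
      + η k * (√(no k : ℝ) * (βhato k w - βo k) / σo)) - ∑ i, g k i (Z k i w)
      = θ k * (rc / σc) + η k * (ro / σo) := by
    rw [Fintype.sum_sum_type]
    simp only [hg, hZdef, Sum.elim_inl, Sum.elim_inr, ← Finset.mul_sum, rc, ro]
    field_simp
    ring
  have hbound : |θ k * (rc / σc) + η k * (ro / σo)| < ε := by
    refine (abs_add_le _ _).trans_lt ?_
    rw [abs_mul, abs_mul, abs_div, abs_div, abs_of_pos hσc, abs_of_pos hσo]
    have a1 : |rc| / σc < ε / 2 := by
      rw [div_lt_iff₀ hσc]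
      linarith
    have a2 : |ro| / σo < ε / 2 := by
      rw [div_lt_iff₀ hσo]
      linarith
    have b1 : |θ k| * (|rc| / σc) ≤ |rc| / σc := mul_le_of_le_one_left (by positivity) hθ
    have b2 : |η k| * (|ro| / σo) ≤ |ro| / σo := mul_le_of_le_one_left (by positivity) hη
    linarith
  simp only [Pi.sub_apply, Pi.zero_apply, sub_zero] at hw
  rw [hdec] at hw
  linarith

end CLT

end AnchoredThresholding

/-! ### Probability of the loss bound -/

namespace AnchoredThresholding

theorem oracleRate_eq {nc no : ℕ} {σc σo : ℝ} (Dbar : ℝ) (hnc : 0 < nc) (hno : 0 < no) :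
    oracleRate nc no σc σo Dbar
      = σc ^ 2 / nc * (σo ^ 2 / no) / (σc ^ 2 / nc + σo ^ 2 / no)
        + min (σc ^ 2 / nc) (Dbar ^ 2) := by
  have h1 : (0 : ℝ) < nc := by exact_mod_cast hnc
  have h2 : (0 : ℝ) < no := by exact_mod_cast hno
  rw [oracleRate, div_mul_div_comm, div_add_div _ _ h1.ne' h2.ne',
    div_div_div_cancel_right₀ (by positivity)]
  ring_nf

theorem oracleRate_nonneg (nc no : ℕ) (σc σo Dbar : ℝ) : 0 ≤ oracleRate nc no σc σo Dbar := by
  unfold oracleRate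
  have : 0 ≤ min (σc ^ 2 / (nc : ℝ)) (Dbar ^ 2) := le_min (by positivity) (sq_nonneg _)
  positivity

/-- The constant in the risk bound. -/
noncomputable def riskConstant (κ lam₀ B : ℝ) : ℝ :=
  3 * (16 * B ^ 2 + B ^ 2 * (1 + 1 / κ) + (4 / lam₀ ^ 2 + 16 * (1 + 1 / κ)))

/-- The loss bound when all standardized estimation errors are controlled. -/
theorem sq_anchoredEstimate_sub_le {nc no : ℕ}
    {κ lam₀ B lam bc bo sc so β βo Dbar σc σo : ℝ} (hnc : 0 < nc) (hno : 0 < no)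
    (hσc : 0 < σc) (hσo : 0 < σo) (hκ : 0 < κ) (hlam₀ : 0 < lam₀) (hlam : lam₀ ≤ lam)
    (hκv : κ * (σo ^ 2 / no) ≤ σc ^ 2 / nc) (hD : |β - βo| ≤ Dbar)
    (hsc : |sc - σc| < σc / 2) (hso : |so - σo| < σo / 2)
    (hU : |√(nc : ℝ) * (bc - β) / σc| < B * lam) (hW : |√(no : ℝ) * (bo - βo) / σo| < B * lam)
    (hUW : |((bc - β) - (bo - βo)) / √(σc ^ 2 / nc + σo ^ 2 / no)| < lam / 2) :
    |anchoredEstimate nc no lam bc bo sc so - β| ^ 2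
      ≤ riskConstant κ lam₀ B * (lam ^ 2 * oracleRate nc no σc σo Dbar) := by
  have h1 : (0 : ℝ) < nc := by exact_mod_cast hnc
  have h2 : (0 : ℝ) < no := by exact_mod_cast hno
  have hvar : ∀ {s σ n : ℝ}, 0 < n → 0 < σ → |s - σ| < σ / 2 →
      σ ^ 2 / n / 4 ≤ s ^ 2 / n ∧ s ^ 2 / n ≤ 4 * (σ ^ 2 / n) := by
    intro s σ n hn hσ hs
    obtain ⟨ha, hb⟩ := abs_lt.1 hs
    constructor
    · rw [div_right_comm]
      gcongr
      nlinarith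
    · rw [← mul_div_assoc]
      gcongr
      nlinarith
  have herr : ∀ {x σ n : ℝ}, 0 < n → 0 < σ → |√n * x / σ| < B * lam →
      x ^ 2 ≤ B ^ 2 * lam ^ 2 * (σ ^ 2 / n) := by
    intro x σ n hn hσ hx
    have h3 : (√n * x / σ) ^ 2 ≤ (B * lam) ^ 2 := by
      rw [← sq_abs]
      gcongr
    rw [div_pow, mul_pow, Real.sq_sqrt hn.le, div_le_iff₀ (by positivity)] at h3
    rw [← mul_div_assoc, le_div_iff₀ hn]
    linarith
  rw [oracleRate_eq Dbar hnc hno, sq_abs]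
  have hs : 0 < √(σc ^ 2 / nc + σo ^ 2 / no) := by positivity
  rw [abs_div, abs_of_pos hs, div_lt_iff₀ hs] at hUW
  obtain ⟨hp, hp'⟩ := hvar h1 hσc hsc
  obtain ⟨hq, hq'⟩ := hvar h2 hσo hso
  have key := sq_weighted_error_le (vc := σc ^ 2 / nc) (vo := σo ^ 2 / no) hκ hlam₀ (by positivity)
    (by positivity) hκv hp hp' hq hq' hD hlam (herr h1 hσc hU) (herr h2 hσo hW) hUW.le
  refine le_trans (le_of_eq ?_) key
  have hx : β - βo + (bc - β) - (bo - βo) = bc - bo := by ring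
  rw [anchoredEstimate, biasEstimate, weightEstimate, hx]
  ring

section Risk

variable {Ω : Type u} {𝒳 : Type v} [MeasurableSpace Ω] [MeasurableSpace 𝒳]
  {P : Measure Ω} [IsProbabilityMeasure P] {nc no : ℕ → ℕ} {Qc Qo : ℕ → Measure (Record 𝒳)}
  {Zc : (k : ℕ) → Fin (nc k) → Ω → Record 𝒳} {Zo : (k : ℕ) → Fin (no k) → Ω → Record 𝒳}
  {βstar βo Dbar : ℕ → ℝ} {ψc ψo : ℕ → Record 𝒳 → ℝ} {σc σo ρc ρo : ℝ}
  {βhatc βhato σhatc σhato : ℕ → Ω → ℝ} {lam : ℕ → ℝ} {κ lam₀ B : ℝ}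

/-- The probability that the loss exceeds the bound is asymptotically at most `exp (-lam² / 16)`. -/
theorem eventually_le_real_risk_le
    (hκ : 0 < κ) (hlam₀ : 0 < lam₀) (hB : 0 < B)
    (hBexp : ∀ s, lam₀ / 2 ≤ s → Real.exp (-((s / 2) ^ 2 / 2))
      + 2 * Real.exp (-((B * s) ^ 2 / 2)) ≤ Real.exp (-(1 / 16) * s ^ 2))
    (hn : Tendsto (fun k => min (nc k) (no k)) atTop atTop)
    (hZ : IndependentSamples P nc no Qc Qo Zc Zo) (hσc : 0 < σc) (hσo : 0 < σo)
    (hmc : ∀ k, Measurable (βhatc k)) (hmo : ∀ k, Measurable (βhato k))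
    (hc : AsymptoticallyLinear P nc Qc Zc βhatc βstar ψc σc ρc)
    (ho : AsymptoticallyLinear P no Qo Zo βhato βo ψo σo ρo)
    (hD : ∀ k, |βstar k - βo k| ≤ Dbar k)
    (hκv : ∀ᶠ k in atTop, κ * (σo ^ 2 / (no k : ℝ)) ≤ σc ^ 2 / (nc k : ℝ))
    (hsc : TendstoInMeasure P σhatc atTop (fun _ => σc))
    (hso : TendstoInMeasure P σhato atTop (fun _ => σo))
    (hlam : ∀ᶠ k in atTop, lam₀ ≤ lam k) {ε : ℝ} (hε : 0 < ε) :
    ∀ᶠ k in atTop, 1 - ε - Real.exp (-(1 / 16) * lam k ^ 2) ≤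
      P.real {w | |anchoredEstimate (nc k) (no k) (lam k) (βhatc k w) (βhato k w) (σhatc k w)
        (σhato k w) - βstar k| ^ 2
          ≤ riskConstant κ lam₀ B
            * (lam k ^ 2 * oracleRate (nc k) (no k) σc σo (Dbar k))} := by
  have hpos : ∀ᶠ k in atTop, 0 < nc k ∧ 0 < no k := by
    filter_upwards [hn.eventually_gt_atTop 0] with k hk
    exact lt_min_iff.1 hk
  set v : ℕ → ℝ := fun k => σc ^ 2 / nc k + σo ^ 2 / no k
  -- `T k` is the difference of the errors over its asymptotic standard deviation; the coefficients
  -- have unit norm but vary with `k`.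
  set T : ℕ → Ω → ℝ := fun k w =>
    (σc / √(nc k : ℝ) / √(v k)) * (√(nc k : ℝ) * (βhatc k w - βstar k) / σc)
    + (-(σo / √(no k : ℝ) / √(v k))) * (√(no k : ℝ) * (βhato k w - βo k) / σo) with hT
  set A : ℕ → Ω → ℝ := fun k w => √(nc k : ℝ) * (βhatc k w - βstar k) / σc
  set O : ℕ → Ω → ℝ := fun k w => √(no k : ℝ) * (βhato k w - βo k) / σo
  have hTlim : TendstoInDistribution T atTop id (fun _ => P) (gaussianReal 0 1) := by
    refine tendstoInDistribution_combination hn hZ hσc hσo hmc hmo hc ho ?_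
    filter_upwards [hpos] with k ⟨h1, h2⟩
    have h1' : (0 : ℝ) < nc k := by exact_mod_cast h1
    have h2' : (0 : ℝ) < no k := by exact_mod_cast h2
    have hvk : 0 < v k := by positivity
    rw [neg_sq, div_pow, div_pow, div_pow, div_pow, Real.sq_sqrt hvk.le, Real.sq_sqrt h1'.le,
      Real.sq_sqrt h2'.le, ← add_div, div_self hvk.ne']
  have hAlim : TendstoInDistribution A atTop id (fun _ => P) (gaussianReal 0 1) := by
    simpa using tendstoInDistribution_combination hn hZ hσc hσo hmc hmo hc ho
      (θ := fun _ => 1) (η := fun _ => 0) (by simp)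
  have hOlim : TendstoInDistribution O atTop id (fun _ => P) (gaussianReal 0 1) := by
    simpa using tendstoInDistribution_combination hn hZ hσc hσo hmc hmo hc ho
      (θ := fun _ => 0) (η := fun _ => 1) (by simp)
  -- Keeping the threshold `s` as a free variable allows the moving value `s = lam k` to be inserted
  -- at the end.
  set f : ℕ → ℝ → ℝ := fun k s => P.real {w | s / 2 ≤ |T k w|} + P.real {w | B * s ≤ |A k w|}
    + P.real {w | B * s ≤ |O k w|} with hf
  have hanti : ∀ k, Antitone (f k) := fun k s t hst => by
    have hmono : ∀ (Y : Ω → ℝ) {x y : ℝ}, x ≤ y →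
        P.real {w | y ≤ |Y w|} ≤ P.real {w | x ≤ |Y w|} := fun Y x y hxy =>
      measureReal_mono fun w hw => hxy.trans hw
    have hBst : B * s ≤ B * t := by gcongr
    exact add_le_add (add_le_add (hmono _ (by linarith)) (hmono _ hBst)) (hmono _ hBst)
  have hinf : Tendsto (fun s : ℝ => Real.exp (-(1 / 16) * s ^ 2)) atTop (𝓝 0) :=
    Real.tendsto_exp_atBot.comp
      ((tendsto_pow_atTop (two_ne_zero)).const_mul_atTop_of_neg (by norm_num))
  have hpt : ∀ t, lam₀ / 2 ≤ t → ∀ η > 0, ∀ᶠ k in atTop,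
      f k t ≤ Real.exp (-(1 / 16) * t ^ 2) + η := by
    intro t ht η hη
    have ht0 : 0 < t := (half_pos hlam₀).trans_le ht
    have hη3 : 0 < η / 3 := by positivity
    filter_upwards [eventually_real_tail_le hTlim (t := t / 2) (by positivity) hη3,
      eventually_real_tail_le hAlim (t := B * t) (by positivity) hη3,
      eventually_real_tail_le hOlim (t := B * t) (by positivity) hη3] with k k1 k2 k3
    have := hBexp t ht
    simp only [hf]
    linarith
  -- Uniformity on `[lam₀, ∞)` needs pointwise bounds slightly further left, hence the start at
  -- `lam₀ / 2`. The budget `ε` is split between these tails and the two scale estimates.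
  have hunif := eventually_forall_ge_le_add (half_lt_self hlam₀) hanti
    (g := fun s => Real.exp (-(1 / 16) * s ^ 2)) (by fun_prop)
    (fun s => Real.exp_nonneg _) hinf hpt (η := ε / 3) (by positivity)
  have hsc' := (tendstoInMeasure_iff_measureReal_norm.1 hsc (σc / 2) (by positivity)).eventually
    (gt_mem_nhds (show 0 < ε / 3 by positivity))
  have hso' := (tendstoInMeasure_iff_measureReal_norm.1 hso (σo / 2) (by positivity)).eventually
    (gt_mem_nhds (show 0 < ε / 3 by positivity))
  filter_upwards [hpos, hunif, hsc', hso', hlam, hκv] with k ⟨h1, h2⟩ hk hck hok hlk hκk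
  have h1' : (0 : ℝ) < nc k := by exact_mod_cast h1
  have h2' : (0 : ℝ) < no k := by exact_mod_cast h2
  have hvk : 0 < v k := by positivity
  set G := {w | |anchoredEstimate (nc k) (no k) (lam k) (βhatc k w) (βhato k w) (σhatc k w)
    (σhato k w) - βstar k| ^ 2
      ≤ riskConstant κ lam₀ B * (lam k ^ 2 * oracleRate (nc k) (no k) σc σo (Dbar k))}
  set S1 := {w | lam k / 2 ≤ |T k w|}
  set S2 := {w | B * lam k ≤ |A k w|}
  set S3 := {w | B * lam k ≤ |O k w|}
  set S4 := {w | σc / 2 ≤ ‖σhatc k w - σc‖}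
  set S5 := {w | σo / 2 ≤ ‖σhato k w - σo‖}
  have hcover : (Set.univ : Set Ω) ⊆ G ∪ (S1 ∪ S2 ∪ S3 ∪ S4 ∪ S5) := by
    intro w _
    by_contra hw
    simp only [Set.mem_union, not_or] at hw
    obtain ⟨hG, ⟨⟨⟨s1, s2⟩, s3⟩, s4⟩, s5⟩ := hw
    refine hG (sq_anchoredEstimate_sub_le h1 h2 hσc hσo hκ hlam₀ hlk hκk (hD k)
      (not_le.1 s4) (not_le.1 s5) (not_le.1 s2) (not_le.1 s3) ?_)
    have hTk : ((βhatc k w - βstar k) - (βhato k w - βo k)) / √(σc ^ 2 / nc k + σo ^ 2 / no k)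
        = T k w := by
      have e1 : √(nc k : ℝ) ≠ 0 := by positivity
      have e2 : √(no k : ℝ) ≠ 0 := by positivity
      have e3 : √(v k) ≠ 0 := by positivity
      change _ / √(v k) = T k w
      simp only [hT]
      field_simp
      ring
    rw [hTk]
    exact not_le.1 s1
  have hone : 1 ≤ P.real G + (P.real S1 + P.real S2 + P.real S3 + P.real S4 + P.real S5) := by
    calc (1 : ℝ) = P.real Set.univ := probReal_univ.symm
      _ ≤ P.real (G ∪ (S1 ∪ S2 ∪ S3 ∪ S4 ∪ S5)) := measureReal_mono hcover
      _ ≤ _ := by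
        refine (measureReal_union_le _ _).trans (add_le_add le_rfl ?_)
        refine (measureReal_union_le _ _).trans (add_le_add ?_ le_rfl)
        refine (measureReal_union_le _ _).trans (add_le_add ?_ le_rfl)
        refine (measureReal_union_le _ _).trans (add_le_add ?_ le_rfl)
        exact measureReal_union_le _ _
  have hfk := hk (lam k) hlk
  simp only [hf] at hfk
  linarith

end Risk

end AnchoredThresholding

/-! ### The asymptotic statement -/

/-- The constant `c` is absolute and `C` depends only on the constants `κ`, `lam₀` implicit in
`σc ^ 2 / nc ≳ σo ^ 2 / no` and `lam ≳ 1`. -/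
theorem theorem3 :
    ∃ c : ℝ, 0 < c ∧
    ∀ κ : ℝ, 0 < κ → ∀ lam₀ : ℝ, 0 < lam₀ →
    ∃ C : ℝ, 0 < C ∧
    ∀ (Ω : Type u) (𝒳 : Type v) [MeasurableSpace Ω] [MeasurableSpace 𝒳]
      (P : Measure Ω) [IsProbabilityMeasure P]
      -- sample sizes, laws of the two populations, data
      (nc no : ℕ → ℕ) (Qc Qo : ℕ → Measure (AnchoredThresholding.Record 𝒳))
      (Zc : (k : ℕ) → Fin (nc k) → Ω → AnchoredThresholding.Record 𝒳)
      (Zo : (k : ℕ) → Fin (no k) → Ω → AnchoredThresholding.Record 𝒳)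
      -- target parameter, limit of the observational estimator, bound on the bias
      (βstar βo Dbar : ℕ → ℝ)
      -- influence functions and their moments
      (ψc ψo : ℕ → AnchoredThresholding.Record 𝒳 → ℝ) (σc σo ρc ρo : ℝ)
      -- the estimators and the tuning parameter
      (βhatc βhato σhatc σhato : ℕ → Ω → ℝ) (lam : ℕ → ℝ),
      Tendsto (fun k => min (nc k) (no k)) atTop atTop →
      AnchoredThresholding.IndependentSamples P nc no Qc Qo Zc Zo →
      0 < σc → 0 < σo →
      (∀ k, Measurable (βhatc k)) → (∀ k, Measurable (βhato k)) →
      (∀ k, Measurable (σhatc k)) → (∀ k, Measurable (σhato k)) →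
      AnchoredThresholding.AsymptoticallyLinear P nc Qc Zc βhatc βstar ψc σc ρc →
      AnchoredThresholding.AsymptoticallyLinear P no Qo Zo βhato βo ψo σo ρo →
      (∀ k, |βstar k - βo k| ≤ Dbar k) →
      (∀ᶠ k in atTop, κ * (σo ^ 2 / (no k : ℝ)) ≤ σc ^ 2 / (nc k : ℝ)) →
      TendstoInMeasure P σhatc atTop (fun _ => σc) →
      TendstoInMeasure P σhato atTop (fun _ => σo) →
      (∀ᶠ k in atTop, lam₀ ≤ lam k) →
      (∃ ε : ℕ → ℝ, Tendsto ε atTop (𝓝 0) ∧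
        ∀ k, 1 - ε k - Real.exp (-c * lam k ^ 2) ≤
          P.real {w | |AnchoredThresholding.anchoredEstimate (nc k) (no k) (lam k) (βhatc k w)
                (βhato k w) (σhatc k w) (σhato k w) - βstar k| ^ 2
              ≤ C * (lam k ^ 2 *
                AnchoredThresholding.oracleRate (nc k) (no k) σc σo (Dbar k))}) ∧
      -- adaptation up to a logarithmic factor, for `lam` of the order of `√(log (min nc no))`
      (∀ a b : ℝ, 0 < a → 0 < b →
        (∀ᶠ k in atTop, a * √(Real.log (min (nc k) (no k) : ℕ)) ≤ lam k ∧
          lam k ≤ b * √(Real.log (min (nc k) (no k) : ℕ))) →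
        Tendsto (fun k =>
          P.real {w | |AnchoredThresholding.anchoredEstimate (nc k) (no k) (lam k) (βhatc k w)
                (βhato k w) (σhatc k w) (σhato k w) - βstar k| ^ 2
              ≤ C * (b ^ 2 * Real.log (min (nc k) (no k) : ℕ) *
                AnchoredThresholding.oracleRate (nc k) (no k) σc σo (Dbar k))})
          atTop (𝓝 1)) := by

  refine ⟨1 / 16, by norm_num, fun κ hκ lam₀ hlam₀ => ?_⟩
  -- `B` is determined by `lam₀` alone and is fixed before the setting is introduced.
  obtain ⟨B, hB, hBexp⟩ := AnchoredThresholding.exists_exp_add_le (half_pos hlam₀)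
  have hC : 0 < AnchoredThresholding.riskConstant κ lam₀ B := by
    unfold AnchoredThresholding.riskConstant
    positivity
  refine ⟨AnchoredThresholding.riskConstant κ lam₀ B, hC, ?_⟩
  intro Ω 𝒳 _ _ P _ nc no Qc Qo Zc Zo βstar βo Dbar ψc ψo σc σo ρc ρo βhatc βhato σhatc σhato lam
    hn hZ hσc hσo hmc hmo _ _ hc ho hD hκv hsc hso hlam
  have key := fun (ε : ℝ) (hε : 0 < ε) => AnchoredThresholding.eventually_le_real_risk_le hκ hlam₀
    hB hBexp hn hZ hσc hσo hmc hmo hc ho hD hκv hsc hso hlam hε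
  set G : ℕ → Set Ω := fun k =>
    {w | |AnchoredThresholding.anchoredEstimate (nc k) (no k) (lam k) (βhatc k w)
      (βhato k w) (σhatc k w) (σhato k w) - βstar k| ^ 2
        ≤ AnchoredThresholding.riskConstant κ lam₀ B * (lam k ^ 2 *
          AnchoredThresholding.oracleRate (nc k) (no k) σc σo (Dbar k))}
  -- The `o(1)` term is the positive part of the deficit: the inequality then holds for every `k`,
  -- and `key` shows that it tends to zero.
  refine ⟨⟨fun k => max 0 (1 - Real.exp (-(1 / 16) * lam k ^ 2) - P.real (G k)), ?_, fun k => ?_⟩,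
    fun a b ha hb hab => ?_⟩
  · refine tendsto_order.2 ⟨fun x hx => Eventually.of_forall fun k => hx.trans_le (le_max_left _ _),
      fun x hx => ?_⟩
    filter_upwards [key (x / 2) (half_pos hx)] with k hk
    exact max_lt hx (by linarith)
  · have := le_max_right 0 (1 - Real.exp (-(1 / 16) * lam k ^ 2) - P.real (G k))
    linarith
  · have hlog : Tendsto (fun k => Real.log (min (nc k) (no k) : ℕ)) atTop atTop :=
      Real.tendsto_log_atTop.comp (tendsto_natCast_atTop_atTop.comp hn)
    have hlaminf : Tendsto lam atTop atTop :=
      tendsto_atTop_mono' _ (hab.mono fun k hk => hk.1)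
        ((Real.tendsto_sqrt_atTop.comp hlog).const_mul_atTop ha)
    have hexp : Tendsto (fun k => Real.exp (-(1 / 16) * lam k ^ 2)) atTop (𝓝 0) :=
      Real.tendsto_exp_atBot.comp
        (((tendsto_pow_atTop two_ne_zero).comp hlaminf).const_mul_atTop_of_neg (by norm_num))
    refine tendsto_order.2 ⟨fun x hx => ?_,
      fun x hx => Eventually.of_forall fun k => measureReal_le_one.trans_lt hx⟩
    have hx' : 0 < (1 - x) / 2 := by linarith
    filter_upwards [key _ hx', hexp.eventually (gt_mem_nhds hx'), hab, hlam,
      hlog.eventually_ge_atTop 0] with k hk hek habk hlk hlogk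
    have hlam2 : lam k ^ 2 ≤ b ^ 2 * Real.log (min (nc k) (no k) : ℕ) := by
      calc lam k ^ 2 ≤ (b * √(Real.log (min (nc k) (no k) : ℕ))) ^ 2 :=
            pow_le_pow_left₀ (hlam₀.le.trans hlk) habk.2 2
        _ = _ := by rw [mul_pow, Real.sq_sqrt hlogk]
    -- Enlarging `lam ^ 2` to `b ^ 2 * log` only enlarges the event, as the oracle rate is
    -- nonnegative.
    have hsub : P.real (G k) ≤ _ := measureReal_mono fun w hw => le_trans hw
      (mul_le_mul_of_nonneg_left (mul_le_mul_of_nonneg_right hlam2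
        (AnchoredThresholding.oracleRate_nonneg (nc k) (no k) σc σo (Dbar k))) hC.le)
    exact lt_of_lt_of_le (by linarith) hsub
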